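/- Let $A\in\mathbb{R}^{m\times n}$, $b\in\mathbb{R}^m$ with $A^Tb\neq 0$, and $\lambda>0$. Put $f(x)=\frac12\|Ax-b\|^2$, $\omega(x)=\lambda\|x\|_1+\frac12\|x\|^2$ (strongly convex with modulus $\mu=1$), and $L=\|AA^T\|$ (spectral norm), where $\|\cdot\|$ is the Euclidean norm of vectors. Let $\overline X$ be the set of minimizers of $f$ on $\mathbb{R}^n$, $\bar f=\min f$, and $\mathcal R(A^T)$ the range of $A^T$. For $x^*\in\partial\omega(x)$ let $D_\omega^{x^*}(z,x)=\omega(z)-\omega(x)-\langle x^*,z-x\rangle$. Consider constants $\tau,\eta>0$ such that (EB) $D_\omega^{x^*}(\bar x,x)\le\tau\|A^TAx-A^Tb\|^2$ for all $x\in\mathbb{R}^n$ and all $x^*\in\partial\omega(x)\cap\mathcal R(A^T)$, where $\bar x$ is the minimizer of $\omega$ over $\overline X$; (QG) $f(x)-\bar f\ge\frac{\eta}{2}\,\mathrm{dist}^2(x,\overline X)$ for all $x\in\mathbb{R}^n$. Then such constants exist, and the following holds. 1. For every such $\tau,\eta$, $f$ satisfies the Bregman distance growth condition $$f(x)-\bar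 f\ \ge\ \frac{\eta}{2\tau L^2}\,\inf_{z\in\overline X}D_\omega^{x^*}(z,x)$$ for all $x\in\mathbb{R}^n$ and all $x^*\in\partial\omega(x)\cap\mathcal R(A^T)$. Moreover $\tau,\eta$ with (EB) and (QG) can be chosen so that this inequality holds for all $x\in\mathbb{R}^n$ and all $x^*\in\partial\omega(x)$. 2. Let $x_0=x_0^*=0$ and, for $k\ge 0$, $x_{k+1}^*=x_k^*-t_kA^T(Ax_k-b)$, $x_{k+1}=\mathcal S_\lambda(x_{k+1}^*)$, where $\mathcal S_\lambda(u)=\max(|u|-\lambda,0)\,\mathrm{sign}(u)$ componentwise. Suppose that for each $k$ either $t_k=\frac1L$, or $t_k$ is an exact solution of $$\min_{t>0}\ \tfrac12\|\mathcal S_\lambda(x_k^*-tA^T(Ax_k-b))\|^2+t\beta_k,\qquad \beta_k=\langle A^T(Ax_k-b),x_k\rangle-\tfrac1L\|A^T(Ax_k-b)\|^2 .$$ Then for every $\tau,\eta>0$ with (EB) and (QG), and all $k\ge 0$, $$\inf_{x\in\overline X}D_\omega^{x_k^*}(x,x_k)\ \le\ \Bigl(1-\Bigl(\frac{\eta}{4\tau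 L^3}\Bigr)^2\Bigr)^k\inf_{x\in\overline X}D_\omega^{x_0^*}(x,x_0).$$ If instead $t_k=t$ for all $k$, with an arbitrary constant $t\in(0,\frac2L)$, the same bound holds with the factor $1-tL(2-tL)\bigl(\frac{\eta}{4\tau L^3}\bigr)^2$ in place of $1-\bigl(\frac{\eta}{4\tau L^3}\bigr)^2$. -/

import Mathlib

open scoped Matrix.Norms.L2Operator

namespace LinBregman

/-- The subdifferential of `w` at `u`. -/
def subdiff {n : ℕ} (w : EuclideanSpace ℝ (Fin n) → ℝ) (u : EuclideanSpace ℝ (Fin n)) :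
    Set (EuclideanSpace ℝ (Fin n)) :=
  {us | ∀ v, w u + inner ℝ us (v - u) ≤ w v}

/-- The Bregman distance `D_w^{vs}(u, v)`; meaningful for `vs ∈ subdiff w v`. -/
noncomputable def bregman {n : ℕ} (w : EuclideanSpace ℝ (Fin n) → ℝ)
    (vs u v : EuclideanSpace ℝ (Fin n)) : ℝ :=
  w u - w v - inner ℝ vs (u - v)

/-- The set of global minimizers of `f`. -/
def minimizers {n : ℕ} (f : EuclideanSpace ℝ (Fin n) → ℝ) : Set (EuclideanSpace ℝ (Fin n)) :=
  {x | ∀ y, f x ≤ f y}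

/-- The infimum over the minimizers `z` of `f` of `D_w^{xs}(z, x)`. -/
noncomputable def bregmanInf {n : ℕ} (w f : EuclideanSpace ℝ (Fin n) → ℝ)
    (xs x : EuclideanSpace ℝ (Fin n)) : ℝ :=
  ⨅ z : minimizers f, bregman w xs z x

/-- The Bregman distance growth condition with constant `γ > 0`, for all points `x` and all
subgradients `xs` of `w` at `x` that lie in the set `S`. With `S = Set.univ` all points and all
subgradients are covered. -/
def BregmanGrowthOn {n : ℕ} (S : Set (EuclideanSpace ℝ (Fin n)))
    (w f : EuclideanSpace ℝ (Fin n) → ℝ) (γ : ℝ) : Prop :=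
  0 < γ ∧ ∀ x, ∀ xs ∈ subdiff w x ∩ S, γ * bregmanInf w f xs x ≤ f x - ⨅ y, f y

/-- The quadratic growth condition with constant `η > 0`. -/
def QuadraticGrowth {n : ℕ} (f : EuclideanSpace ℝ (Fin n) → ℝ) (η : ℝ) : Prop :=
  0 < η ∧ ∀ x, η / 2 * Metric.infDist x (minimizers f) ^ 2 ≤ f x - ⨅ y, f y

/-- `x` solves the bilevel problem: minimize `w` over the minimizers of `f`. -/
def IsBilevelSolution {n : ℕ} (w f : EuclideanSpace ℝ (Fin n) → ℝ)
    (x : EuclideanSpace ℝ (Fin n)) : Prop :=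
  x ∈ minimizers f ∧ ∀ y ∈ minimizers f, w x ≤ w y

/-- `lam * ‖x‖₁ + ‖x‖² / 2`. -/
noncomputable def omega {n : ℕ} (lam : ℝ) (x : EuclideanSpace ℝ (Fin n)) : ℝ :=
  lam * ∑ i, |x i| + 1 / 2 * ‖x‖ ^ 2

/-- `‖A x - b‖² / 2`. -/
noncomputable def leastSq {m n : ℕ} (A : Matrix (Fin m) (Fin n) ℝ) (b : EuclideanSpace ℝ (Fin m))
    (x : EuclideanSpace ℝ (Fin n)) : ℝ :=
  1 / 2 * ‖A.toEuclideanLin x - b‖ ^ 2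

/-- `Aᵀ (A x - b)`, the gradient of `leastSq A b` at `x`. -/
noncomputable def gradLS {m n : ℕ} (A : Matrix (Fin m) (Fin n) ℝ) (b : EuclideanSpace ℝ (Fin m))
    (x : EuclideanSpace ℝ (Fin n)) : EuclideanSpace ℝ (Fin n) :=
  A.transpose.toEuclideanLin (A.toEuclideanLin x - b)

/-- The range of `Aᵀ`. -/
noncomputable def rangeT {m n : ℕ} (A : Matrix (Fin m) (Fin n) ℝ) :
    Set (EuclideanSpace ℝ (Fin n)) :=
  Set.range (fun y : EuclideanSpace ℝ (Fin m) => A.transpose.toEuclideanLin y)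

/-- The spectral norm `‖A Aᵀ‖` (operator norm for the Euclidean norms). -/
noncomputable def lipConst {m n : ℕ} (A : Matrix (Fin m) (Fin n) ℝ) : ℝ :=
  ‖A * A.transpose‖

/-- Componentwise soft shrinkage. -/
noncomputable def shrink {n : ℕ} (lam : ℝ) (x : EuclideanSpace ℝ (Fin n)) :
    EuclideanSpace ℝ (Fin n) :=
  WithLp.toLp 2 (fun i => max (|x i| - lam) 0 * Real.sign (x i))

/-- `x` and `xs` are the primal and dual sequences of the linearized Bregman iteration with
step sizes `t`. -/
structure IsLinBregmanIter {m n : ℕ} (A : Matrix (Fin m) (Fin n) ℝ)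
    (b : EuclideanSpace ℝ (Fin m)) (lam : ℝ) (t : ℕ → ℝ)
    (x xs : ℕ → EuclideanSpace ℝ (Fin n)) : Prop where
  x_zero : x 0 = 0
  xs_zero : xs 0 = 0
  xs_succ : ∀ k, xs (k + 1) = xs k - t k • gradLS A b (x k)
  x_succ : ∀ k, x (k + 1) = shrink lam (xs k - t k • gradLS A b (x k))

/-- The objective of the one-dimensional dual problem for the step size at the point `(x, xs)`. -/
noncomputable def dualObj {m n : ℕ} (A : Matrix (Fin m) (Fin n) ℝ)
    (b : EuclideanSpace ℝ (Fin m)) (lam : ℝ) (x xs : EuclideanSpace ℝ (Fin n)) (t : ℝ) : ℝ :=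
  1 / 2 * ‖shrink lam (xs - t • gradLS A b x)‖ ^ 2
    + t * (inner ℝ (gradLS A b x) x - 1 / lipConst A * ‖gradLS A b x‖ ^ 2)

/-- `t` is an exact solution of: minimize the dual objective over the positive reals. -/
def IsExactStep {m n : ℕ} (A : Matrix (Fin m) (Fin n) ℝ)
    (b : EuclideanSpace ℝ (Fin m)) (lam : ℝ) (x xs : EuclideanSpace ℝ (Fin n)) (t : ℝ) : Prop :=
  0 < t ∧ ∀ s, 0 < s → dualObj A b lam x xs t ≤ dualObj A b lam x xs s

/-- The error bound with constant `τ > 0`: with `xbar` the solution of the bilevel problem,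
`D^{xs}(xbar, x) ≤ τ ‖Aᵀ A x - Aᵀ b‖²` for all `x` and all subgradients `xs` of `omega lam` at `x`
that lie in the range of `Aᵀ`. -/
def ErrorBound {m n : ℕ} (A : Matrix (Fin m) (Fin n) ℝ)
    (b : EuclideanSpace ℝ (Fin m)) (lam τ : ℝ) : Prop :=
  0 < τ ∧ ∃ xbar, IsBilevelSolution (omega lam) (leastSq A b) xbar ∧
    ∀ x, ∀ xs ∈ subdiff (omega lam) x ∩ rangeT A,
      bregman (omega lam) xs xbar x ≤ τ * ‖gradLS A b x‖ ^ 2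

end LinBregman

/-!
Write `L = ‖A Aᵀ‖`, `g x = Aᵀ (A x - b)`, and let `u` be a subgradient of `ω = omega lam` at `x`.
Then `x = shrink lam u`, so the subgradient determines the point, and the Bregman distance is
`D^u(z, x) = ω z + ‖shrink lam u‖² / 2 - ⟪u, z⟫`, with `D^u(z, x) ≥ ‖x - z‖² / 2`.

*Convergence.* For `u` in the range of `Aᵀ` the functional `⟪u, ·⟫` is constant on the minimizers of
`f = leastSq A b`, so the closest minimizer in the Bregman distance is the bilevel solution `x̄`. A
step of size `t` changes `D^u(x̄, x)` by at most the change of the dual objective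
(`bregman_step_le`), and this is at most `-(t / L - t² / 2) ‖g x‖²` (`dualObj_le`); an exact step does
at least as well as `t = 1 / L`. The error bound turns `‖g x‖²` into a fraction of `D^u(x̄, x)`. The
resulting factor is better than the claimed one because at the origin, which is not a minimizer,
the hypotheses force `η ≤ L` and `1 ≤ 2 τ L²` (`IsLinBregmanIter.bregmanInf_le_pow`).

*Error bound.* A solution `u` of the dual problem exists by coercivity, and `shrink lam u` is the
bilevel solution `x̄`. The subgradients at `x̄` in the range of `Aᵀ` form a nonempty polyhedron, and
its constraint violation at `u` is `O(‖x - x̄‖)`. With `p` the point that Hoffman's bound provides,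
`‖x - x̄‖² / 2 ≤ D^u(x̄, x) ≤ ⟪u - p, x - x̄⟫ = O(‖x - x̄‖ ‖g x‖)`, whence `D^u(x̄, x) = O(‖g x‖²)`
(`exists_errorBound`).

*Growth for all subgradients.* Where `z` has the sign pattern of `x`, the Bregman distance is just
`‖x - z‖² / 2`. For each of the finitely many sign patterns, Hoffman's bound gives such a minimizer
`z` with `‖x - z‖ = O(‖g x‖)`, or else `‖g x‖` is bounded away from zero on the pattern
(`exists_bregmanInf_le_gradLS`).

Hoffman's bound itself (`exists_hoffman_constant`) is proved by projection onto the polyhedron and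
compactness of the unit sphere.
-/

namespace LinBregman

/-! ### Hoffman bounds for polyhedra -/

section Hoffman

variable {E : Type*} [NormedAddCommGroup E] [InnerProductSpace ℝ E] [FiniteDimensional ℝ E]

/-- On the polar of the cone `{d | ∀ j ∈ J, a j d ≤ 0}` the norm is controlled by the positive parts
of the functionals `a j`: a vector of the polar at which all of them are nonpositive also lies in
the cone, hence vanishes, and the unit sphere is compact. -/
theorem exists_norm_le_of_mem_polar {ι : Type*} (a : ι → E →ₗ[ℝ] ℝ) (J : Finset ι) :
    ∃ c : ℝ, 0 < c ∧ ∀ v : E, (∀ d, (∀ j ∈ J, a j d ≤ 0) → inner ℝ v d ≤ 0) →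
      ∀ r : ℝ, (∀ j ∈ J, a j v ≤ r) → 0 ≤ r → ‖v‖ ≤ c * r := by
  set K : Set E := Metric.sphere 0 1 ∩ {v | ∀ d, (∀ j ∈ J, a j d ≤ 0) → inner ℝ v d ≤ 0} with hK
  have hKc : IsCompact K := by
    refine (isCompact_sphere (0 : E) 1).inter_right ?_
    simp only [Set.ofPred_forall]
    refine isClosed_iInter fun d => isClosed_iInter fun _ => ?_
    exact isClosed_le (by fun_prop) continuous_const
  have hcont : Continuous fun v : E => ∑ j ∈ J, max (a j v) 0 :=
    continuous_finsetSum _ fun j _ =>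
      ((a j).continuous_of_finiteDimensional).max continuous_const
  have hmin : ∃ δ : ℝ, 0 < δ ∧ ∀ v ∈ K, δ ≤ ∑ j ∈ J, max (a j v) 0 := by
    rcases K.eq_empty_or_nonempty with h | h
    · exact ⟨1, one_pos, by simp [h]⟩
    · obtain ⟨v, hv, hvm⟩ := hKc.exists_isMinOn h hcont.continuousOn
      refine ⟨_, ?_, fun w hw => hvm hw⟩
      refine lt_of_le_of_ne (Finset.sum_nonneg fun j _ => le_max_right _ _) fun h0 => ?_
      have h1 : ∀ j ∈ J, a j v ≤ 0 := fun j hj => by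
        have := (Finset.sum_eq_zero_iff_of_nonneg
          (fun j _ => le_max_right (a j v) (0 : ℝ))).1 h0.symm j hj
        exact this ▸ le_max_left _ _
      have h2 := hv.2 v h1
      rw [real_inner_self_eq_norm_sq, mem_sphere_zero_iff_norm.1 hv.1] at h2
      norm_num at h2
  obtain ⟨δ, hδ, hδK⟩ := hmin
  refine ⟨(J.card + 1) / δ, by positivity, fun v hv r hr hr0 => ?_⟩
  rcases eq_or_ne v 0 with rfl | hv0
  · rw [norm_zero]; positivity
  have hn : 0 < ‖v‖ := norm_pos_iff.2 hv0
  have hm : (‖v‖⁻¹ • v) ∈ K := by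
    refine ⟨by simp [norm_smul, hn.ne'], fun d hd => ?_⟩
    rw [real_inner_smul_left]
    exact mul_nonpos_of_nonneg_of_nonpos (by positivity) (hv d hd)
  have h1 := hδK _ hm
  have h2 : ∑ j ∈ J, max (a j (‖v‖⁻¹ • v)) 0 ≤ ∑ j ∈ J, ‖v‖⁻¹ * r := by
    refine Finset.sum_le_sum fun j hj => max_le ?_ (by positivity)
    rw [map_smul, smul_eq_mul]
    exact mul_le_mul_of_nonneg_left (hr j hj) (by positivity)
  rw [Finset.sum_const, nsmul_eq_mul] at h2
  have h3 : δ * ‖v‖ ≤ J.card * r := by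
    have := mul_le_mul_of_nonneg_right (h1.trans h2) hn.le
    field_simp at this
    linarith
  rw [div_mul_eq_mul_div, le_div_iff₀ hδ]
  nlinarith

/-- **Hoffman's error bound**, with a constant that does not depend on the right-hand sides: the
distance of `x` to a nonempty polyhedron is bounded by a multiple of the constraint violation
at `x`. If `p` is the projection of `x`, then `x - p` lies in the polar of the cone of the
constraints active at `p`. -/
theorem exists_hoffman_constant {ι : Type*} [Finite ι] (a : ι → E →ₗ[ℝ] ℝ) :
    ∃ κ : ℝ, 0 < κ ∧ ∀ β : ι → ℝ, (∃ p, ∀ i, a i p ≤ β i) →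
      ∀ (x : E) (r : ℝ), 0 ≤ r → (∀ i, a i x - β i ≤ r) →
        ∃ p, (∀ i, a i p ≤ β i) ∧ ‖x - p‖ ≤ κ * r := by
  classical
  cases nonempty_fintype ι
  choose c hc0 hc using exists_norm_le_of_mem_polar a
  refine ⟨∑ J, c J, Finset.sum_pos (fun J _ => hc0 J) ⟨∅, Finset.mem_univ _⟩, ?_⟩
  intro β hne x r hr hx
  set P : Set E := {p | ∀ i, a i p ≤ β i} with hP
  have hcl : IsClosed P := by
    simp only [hP, Set.ofPred_forall]
    exact isClosed_iInter fun i =>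
      isClosed_le (a i).continuous_of_finiteDimensional continuous_const
  have hconv : Convex ℝ P := by
    simp only [hP, Set.ofPred_forall]
    exact convex_iInter fun i => convex_halfSpace_le (a i).isLinear _
  obtain ⟨p, hpP, hp⟩ := exists_norm_eq_iInf_of_complete_convex hne hcl.isComplete hconv x
  have hvar := (norm_eq_iInf_iff_real_inner_le_zero hconv hpP).1 hp
  refine ⟨p, hpP, ?_⟩
  set J : Finset ι := Finset.univ.filter fun i => a i p = β i with hJ
  have hpolar : ∀ d, (∀ j ∈ J, a j d ≤ 0) → inner ℝ (x - p) d ≤ 0 := by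
    intro d hd
    -- a small step from `p` in the direction `d` stays in the polyhedron
    have hev : ∀ᶠ ε in nhdsWithin (0 : ℝ) (Set.Ioi 0), ∀ i, a i (p + ε • d) ≤ β i := by
      refine Filter.eventually_all.2 fun i => ?_
      by_cases hi : a i p = β i
      · filter_upwards [self_mem_nhdsWithin] with ε hε
        have := hd i (by simp [hJ, hi])
        rw [map_add, map_smul, smul_eq_mul, hi]
        nlinarith [mul_nonneg (le_of_lt (Set.mem_Ioi.1 hε)) (neg_nonneg.2 this)]
      · have hlt : a i (p + (0 : ℝ) • d) < β i := by
          simpa using lt_of_le_of_ne (hpP i) hi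
        have hct : Continuous fun ε : ℝ => a i (p + ε • d) :=
          (a i).continuous_of_finiteDimensional.comp (by fun_prop)
        exact nhdsWithin_le_nhds ((hct.continuousAt.eventually_lt continuousAt_const hlt).mono
          fun _ h => h.le)
    obtain ⟨ε, hε, hε0⟩ := (hev.and self_mem_nhdsWithin).exists
    have h1 := hvar _ hε
    rw [add_sub_cancel_left, real_inner_smul_right] at h1
    exact nonpos_of_mul_nonpos_right h1 hε0
  have h1 := hc J (x - p) hpolar r (fun j hj => by
    have : a j p = β j := by simpa [hJ] using hj
    rw [map_sub, this]; exact hx j) hr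
  refine h1.trans (mul_le_mul_of_nonneg_right ?_ hr)
  exact Finset.single_le_sum (fun J _ => (hc0 J).le) (Finset.mem_univ J)

/-- Hoffman's bound for the solutions of `G p = y` in a polyhedral cone, at points of the cone. -/
theorem exists_hoffman_constant_cone {ι : Type*} [Finite ι] (c : ι → E →ₗ[ℝ] ℝ) {n : ℕ}
    (G : E →ₗ[ℝ] EuclideanSpace ℝ (Fin n)) :
    ∃ κ : ℝ, 0 < κ ∧ ∀ y, (∃ p, (∀ i, c i p ≤ 0) ∧ G p = y) → ∀ x, (∀ i, c i x ≤ 0) →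
      ∃ p, (∀ i, c i p ≤ 0) ∧ G p = y ∧ ‖x - p‖ ≤ κ * ‖G x - y‖ := by
  let co : Fin n → E →ₗ[ℝ] ℝ := fun i => (EuclideanSpace.proj (𝕜 := ℝ) i).toLinearMap ∘ₗ G
  obtain ⟨κ, hκ, h⟩ := exists_hoffman_constant (Sum.elim c (Sum.elim co fun i => -co i))
  refine ⟨κ, hκ, fun y hne x hx => ?_⟩
  have key : ∀ p, (∀ i, Sum.elim c (Sum.elim co fun i => -co i) i p ≤
      Sum.elim (fun _ => 0) (Sum.elim (fun i => y i) fun i => -y i) i) ↔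
      (∀ i, c i p ≤ 0) ∧ G p = y := by
    intro p
    simp only [Sum.forall, Sum.elim_inl, Sum.elim_inr, co, LinearMap.neg_apply, neg_le_neg_iff]
    refine and_congr Iff.rfl ⟨fun h => ?_, fun h => ?_⟩
    · ext i
      exact le_antisymm (h.1 i) (h.2 i)
    · exact ⟨fun i => by simp [h], fun i => by simp [h]⟩
  obtain ⟨p, hp, hpx⟩ := h (Sum.elim (fun _ => 0) (Sum.elim (fun i => y i) fun i => -y i))
    (by obtain ⟨p, hp⟩ := hne; exact ⟨p, (key p).2 hp⟩) x ‖G x - y‖ (norm_nonneg _) (by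
      have hco : ∀ i, |G x i - y i| ≤ ‖G x - y‖ := fun i => by
        simpa using PiLp.norm_apply_le (G x - y) i
      simp only [Sum.forall, Sum.elim_inl, Sum.elim_inr, co, LinearMap.neg_apply]
      refine ⟨fun i => by linarith [hx i, norm_nonneg (G x - y)], fun i => ?_, fun i => ?_⟩
      · exact (le_abs_self _).trans (hco i)
      · refine le_trans ?_ (hco i)
        rw [abs_sub_comm]
        refine le_trans (le_of_eq ?_) (le_abs_self _)
        simp; ring)
  exact ⟨p, ((key p).1 hp).1, ((key p).1 hp).2, hpx⟩

/-- A linear image of a polyhedral cone keeps a positive distance to each point it misses.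
The bound comes from Hoffman's bound for the homogenized system `G p = t • y`: no solution
has `t > 0`, so the point `(x, 1)` has distance at least `1` to the solution set. -/
theorem exists_pos_le_norm_sub_of_cone {ι : Type*} [Finite ι] (c : ι → E →ₗ[ℝ] ℝ) {n : ℕ}
    (G : E →ₗ[ℝ] EuclideanSpace ℝ (Fin n)) (y : EuclideanSpace ℝ (Fin n))
    (hy : ¬ ∃ p, (∀ i, c i p ≤ 0) ∧ G p = y) :
    ∃ κ : ℝ, 0 < κ ∧ ∀ x, (∀ i, c i x ≤ 0) → 1 ≤ κ * ‖G x - y‖ := by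
  let fst : WithLp 2 (E × ℝ) →ₗ[ℝ] E := LinearMap.fst ℝ E ℝ ∘ₗ (WithLp.linearEquiv 2 ℝ (E × ℝ))
  let snd : WithLp 2 (E × ℝ) →ₗ[ℝ] ℝ := LinearMap.snd ℝ E ℝ ∘ₗ (WithLp.linearEquiv 2 ℝ (E × ℝ))
  obtain ⟨κ, hκ, h⟩ := exists_hoffman_constant_cone (fun i => c i ∘ₗ fst)
    (G ∘ₗ fst - snd.smulRight y)
  refine ⟨κ, hκ, fun x hx => ?_⟩
  obtain ⟨p, hpc, hp0, hpx⟩ := h 0 ⟨0, by simp, by simp⟩ (WithLp.toLp 2 (x, 1))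
    (by simpa [fst] using hx)
  have hp1 : snd p ≤ 0 := by
    by_contra! ht
    refine hy ⟨(snd p)⁻¹ • fst p, fun i => ?_, ?_⟩
    · rw [map_smul, smul_eq_mul]
      exact mul_nonpos_of_nonneg_of_nonpos (by positivity) (hpc i)
    · have : G (fst p) = snd p • y := by simpa [sub_eq_zero] using hp0
      rw [map_smul, this, smul_smul, inv_mul_cancel₀ ht.ne', one_smul]
  have h1 : ‖(WithLp.toLp 2 (x, (1 : ℝ)) - p).snd‖ ≤ ‖WithLp.toLp 2 (x, (1 : ℝ)) - p‖ :=
    WithLp.norm_snd_le _ _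
  have h2 : (WithLp.toLp 2 (x, (1 : ℝ)) - p).snd = 1 - snd p := by simp [snd]
  have h3 : (1 : ℝ) ≤ ‖1 - snd p‖ := by
    rw [Real.norm_eq_abs]; exact le_trans (by linarith) (le_abs_self _)
  rw [h2] at h1
  have h4 : (G ∘ₗ fst - snd.smulRight y) (WithLp.toLp 2 (x, 1)) = G x - y := by simp [fst, snd]
  rw [h4, sub_zero] at hpx
  linarith

end Hoffman

/-! ### Soft shrinkage and the Bregman distance of `omega` -/

/-- Soft shrinkage of a real number; `shrink` applies it to each component. -/
noncomputable def soft (lam u : ℝ) : ℝ :=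
  max (|u| - lam) 0 * Real.sign u

section Soft

variable {lam : ℝ}

theorem soft_cases (hlam : 0 < lam) (u : ℝ) :
    (lam < u ∧ soft lam u = u - lam) ∨ (|u| ≤ lam ∧ soft lam u = 0) ∨
      (u < -lam ∧ soft lam u = u + lam) := by
  unfold soft
  rcases lt_or_ge lam u with h | h
  · left
    rw [abs_of_pos (hlam.trans h), max_eq_left (by linarith), Real.sign_of_pos (hlam.trans h)]
    exact ⟨h, mul_one _⟩
  rcases lt_or_ge u (-lam) with h' | h'
  · right; right
    have hu : u < 0 := by linarith
    rw [abs_of_neg hu, max_eq_left (by linarith), Real.sign_of_neg hu]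
    exact ⟨h', by ring⟩
  · right; left
    have hu : |u| ≤ lam := abs_le.2 ⟨h', h⟩
    rw [max_eq_right (by linarith)]
    exact ⟨hu, zero_mul _⟩

theorem abs_sub_soft_le (hlam : 0 < lam) (u : ℝ) : |u - soft lam u| ≤ lam := by
  rcases soft_cases hlam u with ⟨_, h⟩ | ⟨h', h⟩ | ⟨_, h⟩ <;> rw [h]
  · rw [sub_sub_cancel, abs_of_pos hlam]
  · simpa using h'
  · rw [sub_add_cancel_left, abs_neg, abs_of_pos hlam]

theorem lam_mul_abs_soft (hlam : 0 < lam) (u : ℝ) :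
    lam * |soft lam u| + soft lam u ^ 2 = u * soft lam u := by
  rcases soft_cases hlam u with ⟨h', h⟩ | ⟨h', h⟩ | ⟨h', h⟩ <;> rw [h]
  · rw [abs_of_pos (by linarith)]; ring
  · simp
  · rw [abs_of_neg (by linarith)]; ring

theorem sub_soft_mul_le (hlam : 0 < lam) (u v : ℝ) : (u - soft lam u) * v ≤ lam * |v| := by
  refine (le_abs_self _).trans ?_
  rw [abs_mul]
  exact mul_le_mul_of_nonneg_right (abs_sub_soft_le hlam u) (abs_nonneg v)

/-- The function `u ↦ (soft lam u) ^ 2 / 2` has derivative `soft lam`, which is nonexpansive; this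
is the resulting quadratic upper bound. -/
theorem half_soft_add_sq_le (hlam : 0 < lam) (u h : ℝ) :
    1 / 2 * soft lam (u + h) ^ 2 ≤ 1 / 2 * soft lam u ^ 2 + soft lam u * h + 1 / 2 * h ^ 2 := by
  rcases soft_cases hlam u with ⟨a, e⟩ | ⟨a, e⟩ | ⟨a, e⟩ <;>
  rcases soft_cases hlam (u + h) with ⟨a', e'⟩ | ⟨a', e'⟩ | ⟨a', e'⟩ <;> rw [e, e'] <;>
  (try rw [abs_le] at a) <;> (try rw [abs_le] at a') <;>
  nlinarith

theorem half_sq_sub_le_soft_sq (hlam : 0 < lam) (u : ℝ) :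
    1 / 2 * u ^ 2 - lam ^ 2 ≤ soft lam u ^ 2 := by
  have h := abs_le.1 (abs_sub_soft_le hlam u)
  have h2 : (u - soft lam u) ^ 2 ≤ lam ^ 2 := sq_le_sq' h.1 h.2
  nlinarith [sq_nonneg (u - 2 * soft lam u)]

theorem soft_sq (hlam : 0 < lam) (u : ℝ) : soft lam u ^ 2 = max (|u| - lam) 0 ^ 2 := by
  rcases soft_cases hlam u with ⟨h', h⟩ | ⟨h', h⟩ | ⟨h', h⟩ <;> rw [h]
  · rw [abs_of_pos (hlam.trans h'), max_eq_left (by linarith)]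
  · rw [max_eq_right (by linarith)]
  · rw [abs_of_neg (by linarith : u < 0), max_eq_left (by linarith)]; ring

/-- The preimages of points under soft shrinkage are intervals, and the distance of `u` to the
interval is controlled by the distance of the images. The constant depends on `a`: if `a ≠ 0` and
`soft lam u` does not have the sign of `a`, then the images have distance at least `|a|`. -/
theorem exists_soft_eq_iff (hlam : 0 < lam) (a : ℝ) :
    ∃ l r M : ℝ, 0 ≤ M ∧ (∀ u, soft lam u = a ↔ l ≤ u ∧ u ≤ r) ∧
      ∀ u, l - u ≤ M * |soft lam u - a| ∧ u - r ≤ M * |soft lam u - a| := by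
  rcases lt_trichotomy a 0 with ha | rfl | ha
  · refine ⟨a - lam, a - lam, 1 + 2 * lam / -a, ?_, fun u => ?_, fun u => ?_⟩
    · have := div_nonneg (by positivity : 0 ≤ 2 * lam) (by linarith : (0 : ℝ) ≤ -a)
      linarith
    · rcases soft_cases hlam u with ⟨b, e⟩ | ⟨b, e⟩ | ⟨b, e⟩ <;> rw [e] <;>
      (try rw [abs_le] at b) <;> constructor <;> intro h <;>
      (try constructor) <;> linarith
    · have key : |u - (a - lam)| ≤ (1 + 2 * lam / -a) * |soft lam u - a| := by
        have h1 : |u - (a - lam)| ≤ |soft lam u - a| + |u - soft lam u + lam| := by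
          refine le_trans (le_of_eq ?_) (abs_add_le _ _); congr 1; ring
        have h2 : |u - soft lam u + lam| ≤ 2 * lam / -a * |soft lam u - a| := by
          rw [div_mul_eq_mul_div, le_div_iff₀ (by linarith)]
          have h3 := abs_le.1 (abs_sub_soft_le hlam u)
          rcases soft_cases hlam u with ⟨b, e⟩ | ⟨b, e⟩ | ⟨b, e⟩
          · rw [abs_of_nonneg (by linarith), abs_of_pos (by linarith)]; nlinarith
          · rw [abs_of_nonneg (by linarith), abs_of_pos (by linarith)]; nlinarith
          · rw [e, show u - (u + lam) + lam = 0 by ring, abs_zero, zero_mul]; positivity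
        linarith
      exact ⟨(by linarith [neg_abs_le (u - (a - lam))]), (le_abs_self _).trans key⟩
  · refine ⟨-lam, lam, 1, zero_le_one, fun u => ?_, fun u => ?_⟩
    · rcases soft_cases hlam u with ⟨b, e⟩ | ⟨b, e⟩ | ⟨b, e⟩ <;> rw [e] <;>
      (try rw [abs_le] at b) <;> constructor <;> intro h <;>
      (try constructor) <;> linarith
    · rw [sub_zero, one_mul]
      have h3 := abs_le.1 (abs_sub_soft_le hlam u)
      exact ⟨by linarith [neg_abs_le (soft lam u)], by linarith [le_abs_self (soft lam u)]⟩
  · refine ⟨a + lam, a + lam, 1 + 2 * lam / a, by positivity, fun u => ?_, fun u => ?_⟩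
    · rcases soft_cases hlam u with ⟨b, e⟩ | ⟨b, e⟩ | ⟨b, e⟩ <;> rw [e] <;>
      (try rw [abs_le] at b) <;> constructor <;> intro h <;>
      (try constructor) <;> linarith
    · have key : |u - (a + lam)| ≤ (1 + 2 * lam / a) * |soft lam u - a| := by
        have h1 : |u - (a + lam)| ≤ |soft lam u - a| + |u - soft lam u - lam| := by
          refine le_trans (le_of_eq ?_) (abs_add_le _ _); congr 1; ring
        have h2 : |u - soft lam u - lam| ≤ 2 * lam / a * |soft lam u - a| := by
          rw [div_mul_eq_mul_div, le_div_iff₀ ha]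
          have h3 := abs_le.1 (abs_sub_soft_le hlam u)
          rcases soft_cases hlam u with ⟨b, e⟩ | ⟨b, e⟩ | ⟨b, e⟩
          · rw [e, show u - (u - lam) - lam = 0 by ring, abs_zero, zero_mul]; positivity
          · rw [abs_of_nonpos (by linarith), abs_of_neg (by linarith)]; nlinarith
          · rw [abs_of_nonpos (by linarith), abs_of_neg (by linarith)]; nlinarith
        linarith
      exact ⟨(by linarith [neg_abs_le (u - (a + lam))]), (le_abs_self _).trans key⟩

/-- Where the sign of `z` is compatible with that of `soft lam u`, the Bregman distance of
`lam * |·| + (·) ^ 2 / 2` is quadratic. -/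
theorem bregman_soft_of_abs_le (hlam : 0 < lam) (u z : ℝ)
    (hz : |z| ≤ SignType.sign (soft lam u) * z) :
    lam * |z| + 1 / 2 * z ^ 2 + 1 / 2 * soft lam u ^ 2 - u * z ≤ 1 / 2 * (soft lam u - z) ^ 2 := by
  rcases soft_cases hlam u with ⟨a, e⟩ | ⟨a, e⟩ | ⟨a, e⟩ <;> rw [e] at hz ⊢
  · rw [sign_pos (by linarith)] at hz
    simp only [SignType.coe_one, one_mul] at hz
    nlinarith
  · have : z = 0 := by simpa using hz
    simp [this]
  · rw [sign_neg (by linarith)] at hz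
    simp only [SignType.coe_neg_one] at hz
    nlinarith

theorem bregman_soft_le (hlam : 0 < lam) (u z : ℝ) :
    lam * |z| + 1 / 2 * z ^ 2 + 1 / 2 * soft lam u ^ 2 - u * z ≤
      1 / 2 * (soft lam u - z) ^ 2 + 2 * lam * |soft lam u - z| := by
  have h1 := lam_mul_abs_soft hlam u
  have h2 := sub_soft_mul_le hlam u (soft lam u - z)
  have h3 : |z| ≤ |soft lam u| + |soft lam u - z| := by
    have := abs_sub (soft lam u) (soft lam u - z)
    rwa [sub_sub_cancel] at this
  have h4 := mul_le_mul_of_nonneg_left h3 hlam.le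
  nlinarith

end Soft

section Omega

variable {n : ℕ} {lam : ℝ}

theorem shrink_apply (lam : ℝ) (u : EuclideanSpace ℝ (Fin n)) (i : Fin n) :
    shrink lam u i = soft lam (u i) := rfl

theorem omega_eq_sum (lam : ℝ) (x : EuclideanSpace ℝ (Fin n)) :
    omega lam x = ∑ i, (lam * |x i| + 1 / 2 * x i ^ 2) := by
  rw [omega, EuclideanSpace.real_norm_sq_eq, Finset.sum_add_distrib, Finset.mul_sum,
    Finset.mul_sum]

theorem inner_eq_sum (x y : EuclideanSpace ℝ (Fin n)) : inner ℝ x y = ∑ i, x i * y i := by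
  rw [PiLp.inner_apply]
  exact Finset.sum_congr rfl fun i _ => by simp [mul_comm]

/-- Equality in the Fenchel–Young inequality: the conjugate of `omega lam` at `u` is
`‖shrink lam u‖ ^ 2 / 2`. -/
theorem omega_shrink (hlam : 0 < lam) (u : EuclideanSpace ℝ (Fin n)) :
    omega lam (shrink lam u) - inner ℝ u (shrink lam u) = -(1 / 2 * ‖shrink lam u‖ ^ 2) := by
  rw [omega_eq_sum, inner_eq_sum, EuclideanSpace.real_norm_sq_eq, ← Finset.sum_sub_distrib,
    Finset.mul_sum, ← Finset.sum_neg_distrib]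
  refine Finset.sum_congr rfl fun i _ => ?_
  have := lam_mul_abs_soft hlam (u i)
  simp only [shrink_apply]
  linarith

theorem bregman_shrink (hlam : 0 < lam) (u z : EuclideanSpace ℝ (Fin n)) :
    bregman (omega lam) u z (shrink lam u) =
      omega lam z + 1 / 2 * ‖shrink lam u‖ ^ 2 - inner ℝ u z := by
  rw [bregman, inner_sub_right]
  linarith [omega_shrink hlam u]

theorem bregman_shrink_eq_sum (hlam : 0 < lam) (u z : EuclideanSpace ℝ (Fin n)) :
    bregman (omega lam) u z (shrink lam u) =
      ∑ i, (lam * |z i| + 1 / 2 * z i ^ 2 + 1 / 2 * soft lam (u i) ^ 2 - u i * z i) := by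
  rw [bregman_shrink hlam, omega_eq_sum, inner_eq_sum, EuclideanSpace.real_norm_sq_eq,
    Finset.mul_sum, ← Finset.sum_add_distrib, ← Finset.sum_sub_distrib]
  rfl

/-- Strong convexity of `omega lam` with modulus `1`. -/
theorem half_norm_sq_le_bregman_shrink (hlam : 0 < lam) (u z : EuclideanSpace ℝ (Fin n)) :
    1 / 2 * ‖shrink lam u - z‖ ^ 2 ≤ bregman (omega lam) u z (shrink lam u) := by
  rw [bregman_shrink_eq_sum hlam, EuclideanSpace.real_norm_sq_eq, Finset.mul_sum]
  refine Finset.sum_le_sum fun i _ => ?_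
  have := sub_soft_mul_le hlam (u i) (z i)
  rw [PiLp.sub_apply, shrink_apply]
  linarith

theorem mem_subdiff_omega_shrink (hlam : 0 < lam) (u : EuclideanSpace ℝ (Fin n)) :
    u ∈ subdiff (omega lam) (shrink lam u) := by
  intro z
  have h := half_norm_sq_le_bregman_shrink hlam u z
  rw [bregman] at h
  linarith [sq_nonneg ‖shrink lam u - z‖]

theorem eq_shrink_of_mem_subdiff (hlam : 0 < lam) {u x : EuclideanSpace ℝ (Fin n)}
    (h : u ∈ subdiff (omega lam) x) : x = shrink lam u := by
  have h1 := half_norm_sq_le_bregman_shrink hlam u x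
  have h2 := h (shrink lam u)
  rw [bregman] at h1
  have h3 : inner ℝ u (shrink lam u - x) = - inner ℝ u (x - shrink lam u) := by
    rw [← inner_neg_right, neg_sub]
  have h4 : ‖shrink lam u - x‖ = 0 := by
    refine pow_eq_zero_iff two_ne_zero |>.1 (le_antisymm ?_ (sq_nonneg _))
    linarith
  exact (sub_eq_zero.1 (norm_eq_zero.1 h4)).symm

theorem half_norm_shrink_add_sq_le (hlam : 0 < lam) (u h : EuclideanSpace ℝ (Fin n)) :
    1 / 2 * ‖shrink lam (u + h)‖ ^ 2 ≤
      1 / 2 * ‖shrink lam u‖ ^ 2 + inner ℝ (shrink lam u) h + 1 / 2 * ‖h‖ ^ 2 := by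
  simp only [EuclideanSpace.real_norm_sq_eq, inner_eq_sum, Finset.mul_sum,
    ← Finset.sum_add_distrib]
  exact Finset.sum_le_sum fun i _ => half_soft_add_sq_le hlam (u i) (h i)

theorem continuous_norm_shrink_sq (hlam : 0 < lam) :
    Continuous fun u : EuclideanSpace ℝ (Fin n) => ‖shrink lam u‖ ^ 2 := by
  simp only [EuclideanSpace.real_norm_sq_eq, shrink_apply, soft_sq hlam]
  fun_prop

theorem half_norm_sq_sub_le_norm_shrink_sq (hlam : 0 < lam) (u : EuclideanSpace ℝ (Fin n)) :
    1 / 2 * ‖u‖ ^ 2 - n * lam ^ 2 ≤ ‖shrink lam u‖ ^ 2 := by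
  have h := Finset.sum_le_sum fun i (_ : i ∈ Finset.univ) => half_sq_sub_le_soft_sq hlam (u i)
  rw [Finset.sum_sub_distrib, ← Finset.mul_sum, Finset.sum_const, Finset.card_univ,
    Fintype.card_fin, nsmul_eq_mul] at h
  simpa only [EuclideanSpace.real_norm_sq_eq, shrink_apply] using h

end Omega

/-! ### The least squares functional -/

section LeastSquares

variable {m n : ℕ} (A : Matrix (Fin m) (Fin n) ℝ) (b : EuclideanSpace ℝ (Fin m))

theorem inner_transpose_toEuclideanLin (y : EuclideanSpace ℝ (Fin m))
    (x : EuclideanSpace ℝ (Fin n)) :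
    inner ℝ (A.transpose.toEuclideanLin y) x = inner ℝ y (A.toEuclideanLin x) := by
  rw [← Matrix.conjTranspose_eq_transpose_of_trivial,
    Matrix.toEuclideanLin_conjTranspose_eq_adjoint, LinearMap.adjoint_inner_left]

theorem lipConst_nonneg : 0 ≤ lipConst A := norm_nonneg _

theorem norm_transpose_sq_le (y : EuclideanSpace ℝ (Fin m)) :
    ‖A.transpose.toEuclideanLin y‖ ^ 2 ≤ lipConst A * ‖y‖ ^ 2 := by
  have h : A.toEuclideanLin (A.transpose.toEuclideanLin y) =
      (A * A.transpose).toEuclideanLin y := by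
    simp [Matrix.toLpLin_apply, Matrix.mulVec_mulVec]
  have h2 : ‖(A * A.transpose).toEuclideanLin y‖ ≤ lipConst A * ‖y‖ :=
    (A * A.transpose).l2_opNorm_mulVec y
  rw [← real_inner_self_eq_norm_sq, inner_transpose_toEuclideanLin, h]
  refine (real_inner_le_norm _ _).trans ?_
  nlinarith [norm_nonneg y]

theorem norm_sq_le (x : EuclideanSpace ℝ (Fin n)) :
    ‖A.toEuclideanLin x‖ ^ 2 ≤ lipConst A * ‖x‖ ^ 2 := by
  set y := A.toEuclideanLin x with hy
  have h1 : ‖y‖ ^ 2 ≤ ‖A.transpose.toEuclideanLin y‖ * ‖x‖ := by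
    rw [← real_inner_self_eq_norm_sq]
    nth_rw 2 [hy]
    rw [← inner_transpose_toEuclideanLin]
    exact real_inner_le_norm _ _
  have h2 := norm_transpose_sq_le A y
  rcases (sq_nonneg ‖y‖).eq_or_lt with h0 | h0
  · rw [← h0]; exact mul_nonneg (lipConst_nonneg A) (sq_nonneg _)
  have h3 : (‖y‖ ^ 2) * ‖y‖ ^ 2 ≤ (lipConst A * ‖x‖ ^ 2) * ‖y‖ ^ 2 := by
    calc (‖y‖ ^ 2) * ‖y‖ ^ 2 ≤ (‖A.transpose.toEuclideanLin y‖ * ‖x‖) *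
        (‖A.transpose.toEuclideanLin y‖ * ‖x‖) := by gcongr
      _ = ‖A.transpose.toEuclideanLin y‖ ^ 2 * ‖x‖ ^ 2 := by ring
      _ ≤ (lipConst A * ‖y‖ ^ 2) * ‖x‖ ^ 2 := by gcongr
      _ = _ := by ring
  exact le_of_mul_le_mul_right h3 h0

theorem lipConst_pos {A : Matrix (Fin m) (Fin n) ℝ} {b : EuclideanSpace ℝ (Fin m)}
    (hAb : A.transpose.toEuclideanLin b ≠ 0) : 0 < lipConst A := by
  refine (lipConst_nonneg A).lt_of_ne fun h => hAb ?_
  have := norm_transpose_sq_le A b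
  rw [← h, zero_mul] at this
  exact norm_eq_zero.1 (pow_eq_zero_iff two_ne_zero |>.1 (this.antisymm (sq_nonneg _)))

theorem exists_gradLS_eq_zero : ∃ z, gradLS A b z = 0 := by
  obtain ⟨y, ⟨z, rfl⟩, r, hr, hb⟩ :=
    (LinearMap.range A.toEuclideanLin).exists_add_mem_mem_orthogonal b
  refine ⟨z, ?_⟩
  rw [gradLS, hb, sub_add_cancel_left, map_neg, neg_eq_zero]
  refine ext_inner_right ℝ fun v => ?_
  rw [inner_transpose_toEuclideanLin, inner_zero_left]
  exact Submodule.inner_left_of_mem_orthogonal (LinearMap.mem_range_self _ v) hr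

variable {A b}

theorem gradLS_add (x h : EuclideanSpace ℝ (Fin n)) :
    gradLS A b (x + h) = gradLS A b x + A.transpose.toEuclideanLin (A.toEuclideanLin h) := by
  rw [gradLS, gradLS, ← map_add, map_add]
  congr 1; abel

theorem gradLS_eq {z : EuclideanSpace ℝ (Fin n)} (hz : gradLS A b z = 0)
    (x : EuclideanSpace ℝ (Fin n)) :
    gradLS A b x = A.transpose.toEuclideanLin (A.toEuclideanLin (x - z)) := by
  have := gradLS_add (A := A) (b := b) z (x - z)
  rwa [add_sub_cancel, hz, zero_add] at this

theorem leastSq_eq {z : EuclideanSpace ℝ (Fin n)} (hz : gradLS A b z = 0)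
    (x : EuclideanSpace ℝ (Fin n)) :
    leastSq A b x = leastSq A b z + 1 / 2 * ‖A.toEuclideanLin (x - z)‖ ^ 2 := by
  have h : A.toEuclideanLin x - b = (A.toEuclideanLin z - b) + A.toEuclideanLin (x - z) := by
    rw [map_sub]; abel
  rw [leastSq, leastSq, h, norm_add_sq_real, ← inner_transpose_toEuclideanLin]
  rw [gradLS] at hz
  rw [hz, inner_zero_left]
  ring

theorem mem_minimizers_leastSq {x : EuclideanSpace ℝ (Fin n)} :
    x ∈ minimizers (leastSq A b) ↔ gradLS A b x = 0 := by
  refine ⟨fun h => ?_, fun h y => ?_⟩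
  · obtain ⟨z, hz⟩ := exists_gradLS_eq_zero A b
    have h1 := h z
    rw [leastSq_eq hz x] at h1
    have h2 : ‖A.toEuclideanLin (x - z)‖ = 0 :=
      pow_eq_zero_iff two_ne_zero |>.1 (le_antisymm (by linarith) (sq_nonneg _))
    rw [gradLS_eq hz, norm_eq_zero.1 h2, map_zero]
  · rw [leastSq_eq h y]
    linarith [sq_nonneg ‖A.toEuclideanLin (y - x)‖]

theorem iInf_leastSq {z : EuclideanSpace ℝ (Fin n)} (hz : gradLS A b z = 0) :
    ⨅ y, leastSq A b y = leastSq A b z :=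
  le_antisymm (ciInf_le ⟨leastSq A b z, by rintro _ ⟨y, rfl⟩; exact mem_minimizers_leastSq.2 hz y⟩ z)
    (le_ciInf (mem_minimizers_leastSq.2 hz))

theorem leastSq_sub_iInf {z : EuclideanSpace ℝ (Fin n)} (hz : gradLS A b z = 0)
    (x : EuclideanSpace ℝ (Fin n)) :
    leastSq A b x - ⨅ y, leastSq A b y = 1 / 2 * ‖A.toEuclideanLin (x - z)‖ ^ 2 := by
  rw [iInf_leastSq hz, leastSq_eq hz x]; ring

theorem norm_gradLS_sq_le (x : EuclideanSpace ℝ (Fin n)) :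
    ‖gradLS A b x‖ ^ 2 ≤ 2 * lipConst A * (leastSq A b x - ⨅ y, leastSq A b y) := by
  obtain ⟨z, hz⟩ := exists_gradLS_eq_zero A b
  rw [leastSq_sub_iInf hz, gradLS_eq hz]
  refine (norm_transpose_sq_le A _).trans (le_of_eq (by ring))

theorem norm_gradLS_sq_le_norm_sub {z : EuclideanSpace ℝ (Fin n)} (hz : gradLS A b z = 0)
    (x : EuclideanSpace ℝ (Fin n)) :
    ‖gradLS A b x‖ ^ 2 ≤ lipConst A ^ 2 * ‖x - z‖ ^ 2 := by
  rw [gradLS_eq hz]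
  refine (norm_transpose_sq_le A _).trans ?_
  rw [sq (lipConst A), mul_assoc]
  exact mul_le_mul_of_nonneg_left (norm_sq_le A _) (lipConst_nonneg A)

variable (A) in
/-- Modulo the kernel of `A`, each vector `h` is equal to its component in the range of `Aᵀ`, on
which `Aᵀ A` is bounded below. -/
theorem exists_norm_le_transpose_mul :
    ∃ C : ℝ, 0 < C ∧ ∀ h, ∃ v ∈ rangeT A, A.toEuclideanLin v = A.toEuclideanLin h ∧
      (∀ w ∈ rangeT A, inner ℝ w v = inner ℝ w h) ∧
      ‖v‖ ≤ C * ‖A.transpose.toEuclideanLin (A.toEuclideanLin h)‖ := by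
  set V := LinearMap.range A.transpose.toEuclideanLin with hV
  let B : V →ₗ[ℝ] EuclideanSpace ℝ (Fin n) :=
    A.transpose.toEuclideanLin ∘ₗ A.toEuclideanLin ∘ₗ V.subtype
  have hB : LinearMap.ker B = ⊥ := by
    refine LinearMap.ker_eq_bot'.2 fun v hv => ?_
    have h1 : A.toEuclideanLin v = 0 := by
      refine inner_self_eq_zero (𝕜 := ℝ).1 ?_
      rw [← inner_transpose_toEuclideanLin]
      exact (congrArg (fun w => inner ℝ w (v : EuclideanSpace ℝ (Fin n))) hv).trans
        (inner_zero_left _)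
    obtain ⟨v, y, rfl⟩ := v
    refine Subtype.ext (inner_self_eq_zero (𝕜 := ℝ).1 ?_)
    rw [inner_transpose_toEuclideanLin, h1, inner_zero_right]
  obtain ⟨K, hK, hKB⟩ := B.exists_antilipschitzWith hB
  refine ⟨K, hK, fun h => ?_⟩
  obtain ⟨v, hv, r, hr, rfl⟩ := V.exists_add_mem_mem_orthogonal h
  have hAr : A.toEuclideanLin r = 0 := by
    refine inner_self_eq_zero (𝕜 := ℝ).1 ?_
    rw [← inner_transpose_toEuclideanLin]
    exact Submodule.inner_right_of_mem_orthogonal (K := V) ⟨_, rfl⟩ hr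
  have hA : A.toEuclideanLin (v + r) = A.toEuclideanLin v := by rw [map_add, hAr, add_zero]
  refine ⟨v, hv, hA.symm, fun w hw => ?_, ?_⟩
  · rw [inner_add_right, Submodule.inner_right_of_mem_orthogonal (K := V) hw hr, add_zero]
  · rw [hA]
    have := hKB.le_mul_dist ⟨v, hv⟩ 0
    simpa [B] using this

/-- Every point `x` has a minimizer of `leastSq A b` within a multiple of `‖gradLS A b x‖`. -/
theorem exists_norm_sub_le_gradLS (A : Matrix (Fin m) (Fin n) ℝ) :
    ∃ C : ℝ, 0 < C ∧ ∀ (b : EuclideanSpace ℝ (Fin m)) (x : EuclideanSpace ℝ (Fin n)),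
      ∃ z, gradLS A b z = 0 ∧ ‖x - z‖ ≤ C * ‖gradLS A b x‖ := by
  obtain ⟨C, hC, h⟩ := exists_norm_le_transpose_mul A
  refine ⟨C, hC, fun b x => ?_⟩
  obtain ⟨z, hz⟩ := exists_gradLS_eq_zero A b
  obtain ⟨v, -, hv, -, hn⟩ := h (x - z)
  refine ⟨x - v, ?_, ?_⟩
  · rw [gradLS_eq hz, show x - v - z = (x - z) - v by abel, map_sub, hv, sub_self, map_zero]
  · rw [sub_sub_cancel, gradLS_eq hz x]
    exact hn

theorem exists_quadraticGrowth (A : Matrix (Fin m) (Fin n) ℝ) (b : EuclideanSpace ℝ (Fin m))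
    (hL : 0 < lipConst A) : ∃ η, QuadraticGrowth (leastSq A b) η := by
  obtain ⟨C, hC, h⟩ := exists_norm_sub_le_gradLS A
  refine ⟨1 / (C ^ 2 * lipConst A), by positivity, fun x => ?_⟩
  obtain ⟨z, hz, hxz⟩ := h b x
  have h1 : Metric.infDist x (minimizers (leastSq A b)) ≤ ‖x - z‖ := by
    rw [← dist_eq_norm]
    exact Metric.infDist_le_dist_of_mem (mem_minimizers_leastSq.2 hz)
  have h2 : Metric.infDist x (minimizers (leastSq A b)) ^ 2 ≤ (C * ‖gradLS A b x‖) ^ 2 :=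
    pow_le_pow_left₀ Metric.infDist_nonneg (h1.trans hxz) 2
  have h3 := norm_gradLS_sq_le (A := A) (b := b) x
  have h4 : Metric.infDist x (minimizers (leastSq A b)) ^ 2 ≤
      C ^ 2 * (2 * lipConst A * (leastSq A b x - ⨅ y, leastSq A b y)) := by
    rw [mul_pow] at h2
    exact h2.trans (by gcongr)
  calc 1 / (C ^ 2 * lipConst A) / 2 * Metric.infDist x (minimizers (leastSq A b)) ^ 2
      ≤ 1 / (C ^ 2 * lipConst A) / 2 *
        (C ^ 2 * (2 * lipConst A * (leastSq A b x - ⨅ y, leastSq A b y))) := by gcongr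
    _ = _ := by field_simp

end LeastSquares

/-! ### The bilevel problem and the error bound -/

section Bilevel

variable {m n : ℕ} {A : Matrix (Fin m) (Fin n) ℝ} {b : EuclideanSpace ℝ (Fin m)} {lam : ℝ}

/-- The dual of minimizing `omega lam` subject to `A x = A z` has a solution. It is a minimizer
`u` of `‖shrink lam u‖ ^ 2 / 2 - ⟪u, z⟫` over the range of `Aᵀ`, a coercive function whose
gradient is `shrink lam u - z`; the point `shrink lam u` is then feasible. -/
theorem exists_mem_rangeT_shrink (A : Matrix (Fin m) (Fin n) ℝ) (hlam : 0 < lam)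
    (z : EuclideanSpace ℝ (Fin n)) :
    ∃ u ∈ rangeT A, A.toEuclideanLin (shrink lam u - z) = 0 := by
  set V := LinearMap.range A.transpose.toEuclideanLin with hV
  let φ : V → ℝ := fun u => 1 / 2 * ‖shrink lam (u : EuclideanSpace ℝ (Fin n))‖ ^ 2 -
    inner ℝ (u : EuclideanSpace ℝ (Fin n)) z
  have hφ : Continuous φ := by
    have := (continuous_norm_shrink_sq (n := n) hlam).comp (continuous_subtype_val (p := (· ∈ V)))
    exact (continuous_const.mul this).sub (by fun_prop)
  have hφ0 : φ 0 = 0 := by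
    have : shrink lam (0 : EuclideanSpace ℝ (Fin n)) = 0 := by
      ext i; simp [shrink]
    simp [φ, this]
  have hlarge : ∀ u : V, 4 * ‖z‖ + 2 * n * lam ^ 2 + 1 ≤ ‖u‖ → φ 0 ≤ φ u := by
    intro u hu
    have h1 := half_norm_sq_sub_le_norm_shrink_sq hlam (u : EuclideanSpace ℝ (Fin n))
    have h2 := real_inner_le_norm (u : EuclideanSpace ℝ (Fin n)) z
    rw [hφ0]
    simp only [φ]
    rw [Submodule.coe_norm] at hu
    have h3 : 0 ≤ (n : ℝ) * lam ^ 2 := by positivity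
    have h4 := mul_le_mul_of_nonneg_left hu (norm_nonneg (u : EuclideanSpace ℝ (Fin n)))
    have h5 : (1 : ℝ) ≤ ‖(u : EuclideanSpace ℝ (Fin n))‖ := by linarith [norm_nonneg z]
    nlinarith [mul_le_mul_of_nonneg_right h5 h3]
  have hev : ∀ᶠ u in Filter.cocompact V, φ 0 ≤ φ u :=
    ((tendsto_norm_cocompact_atTop (E := V)).eventually_ge_atTop _).mono hlarge
  obtain ⟨u, hu⟩ := hφ.exists_forall_le' 0 hev
  refine ⟨u, u.2, ?_⟩
  set h := A.toEuclideanLin (shrink lam (u : EuclideanSpace ℝ (Fin n)) - z) with hh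
  set w : EuclideanSpace ℝ (Fin n) := A.transpose.toEuclideanLin h with hw
  -- `shrink lam u - z` is the gradient of `φ`, but need not lie in the range of `Aᵀ`; its image `w`
  -- under `Aᵀ A` does, and `-w` is a descent direction unless `h = 0`
  set s : ℝ := 1 / (lipConst A + 1) with hs
  have hL := lipConst_nonneg A
  have h1 : φ u ≤ φ (u + (-s) • ⟨w, h, rfl⟩) := hu _
  have h2 := half_norm_shrink_add_sq_le hlam (u : EuclideanSpace ℝ (Fin n)) ((-s) • w)
  have h3 : inner ℝ (shrink lam (u : EuclideanSpace ℝ (Fin n))) w - inner ℝ w z = ‖h‖ ^ 2 := by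
    rw [real_inner_comm, ← inner_sub_right, hw, inner_transpose_toEuclideanLin, ← hh,
      real_inner_self_eq_norm_sq]
  have h4 : ‖w‖ ^ 2 ≤ lipConst A * ‖h‖ ^ 2 := norm_transpose_sq_le A h
  simp only [φ, Submodule.coe_add, Submodule.coe_smul] at h1
  rw [inner_smul_right, norm_smul, mul_pow, norm_neg, Real.norm_eq_abs, sq_abs] at h2
  rw [inner_add_left, real_inner_smul_left] at h1
  have h5 : s * ‖h‖ ^ 2 ≤ 1 / 2 * (s ^ 2 * ‖w‖ ^ 2) := by
    rw [← h3]; linarith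
  have hs0 : 0 < s := by positivity
  have hs1 : s * lipConst A ≤ 1 := by
    rw [hs, one_div_mul_eq_div, div_le_one (by linarith)]; linarith
  have h6 : s * ‖h‖ ^ 2 ≤ 1 / 2 * (s * ‖h‖ ^ 2) := by
    refine h5.trans ?_
    have : s ^ 2 * ‖w‖ ^ 2 ≤ (s * lipConst A) * (s * ‖h‖ ^ 2) :=
      (mul_le_mul_of_nonneg_left h4 (sq_nonneg s)).trans (le_of_eq (by ring))
    have h7 : (s * lipConst A) * (s * ‖h‖ ^ 2) ≤ 1 * (s * ‖h‖ ^ 2) :=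
      mul_le_mul_of_nonneg_right hs1 (by positivity)
    linarith
  have h7 : ‖h‖ ^ 2 ≤ 0 := by
    by_contra! hc
    linarith [mul_pos hs0 hc]
  exact norm_eq_zero.1 (pow_eq_zero_iff two_ne_zero |>.1 (h7.antisymm (sq_nonneg _)))

theorem map_eq_of_gradLS_eq_zero {z z' : EuclideanSpace ℝ (Fin n)} (hz : gradLS A b z = 0)
    (hz' : gradLS A b z' = 0) : A.toEuclideanLin z = A.toEuclideanLin z' := by
  have h := leastSq_eq hz z'
  have h' := mem_minimizers_leastSq.2 hz' z
  have h2 : ‖A.toEuclideanLin (z' - z)‖ = 0 :=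
    pow_eq_zero_iff two_ne_zero |>.1 (le_antisymm (by linarith) (sq_nonneg _))
  rw [norm_eq_zero, map_sub, sub_eq_zero] at h2
  exact h2.symm

/-- The elements of the range of `Aᵀ` are constant on the set of minimizers. -/
theorem inner_eq_of_mem_rangeT {u z z' : EuclideanSpace ℝ (Fin n)} (hu : u ∈ rangeT A)
    (hz : gradLS A b z = 0) (hz' : gradLS A b z' = 0) : inner ℝ u z = inner ℝ u z' := by
  obtain ⟨y, rfl⟩ := hu
  simp only [inner_transpose_toEuclideanLin, map_eq_of_gradLS_eq_zero hz hz']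

theorem bregman_nonneg {w : EuclideanSpace ℝ (Fin n) → ℝ} {xs x : EuclideanSpace ℝ (Fin n)}
    (h : xs ∈ subdiff w x) (z : EuclideanSpace ℝ (Fin n)) : 0 ≤ bregman w xs z x := by
  have := h z
  rw [bregman]; linarith

theorem bregmanInf_le {w f : EuclideanSpace ℝ (Fin n) → ℝ} {xs x z : EuclideanSpace ℝ (Fin n)}
    (h : xs ∈ subdiff w x) (hz : z ∈ minimizers f) :
    bregmanInf w f xs x ≤ bregman w xs z x :=
  ciInf_le (f := fun z : minimizers f => bregman w xs z x)
    ⟨0, by rintro _ ⟨y, rfl⟩; exact bregman_nonneg h y⟩ ⟨z, hz⟩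

/-- For subgradients in the range of `Aᵀ`, the closest minimizer in the Bregman distance is always
the solution of the bilevel problem. -/
theorem bregmanInf_eq {xbar xs x : EuclideanSpace ℝ (Fin n)}
    (hbar : IsBilevelSolution (omega lam) (leastSq A b) xbar)
    (hxs : xs ∈ subdiff (omega lam) x) (hxsA : xs ∈ rangeT A) :
    bregmanInf (omega lam) (leastSq A b) xs x = bregman (omega lam) xs xbar x := by
  refine le_antisymm (bregmanInf_le hxs hbar.1) ?_
  have : Nonempty (minimizers (leastSq A b)) := ⟨⟨xbar, hbar.1⟩⟩
  refine le_ciInf fun z => ?_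
  have h1 := hbar.2 z z.2
  have h2 := inner_eq_of_mem_rangeT hxsA (mem_minimizers_leastSq.1 hbar.1)
    (mem_minimizers_leastSq.1 z.2)
  rw [bregman, bregman, inner_sub_right, inner_sub_right]
  linarith

/-- Optimality condition for the bilevel problem, which also gives existence of its solution. -/
theorem exists_isBilevelSolution_shrink (A : Matrix (Fin m) (Fin n) ℝ)
    (b : EuclideanSpace ℝ (Fin m)) (hlam : 0 < lam) :
    ∃ u ∈ rangeT A, IsBilevelSolution (omega lam) (leastSq A b) (shrink lam u) := by
  obtain ⟨z, hz⟩ := exists_gradLS_eq_zero A b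
  obtain ⟨u, hu, hA⟩ := exists_mem_rangeT_shrink A hlam z
  have hg : gradLS A b (shrink lam u) = 0 := by rw [gradLS_eq hz, hA, map_zero]
  refine ⟨u, hu, mem_minimizers_leastSq.2 hg, fun y hy => ?_⟩
  have h1 := mem_subdiff_omega_shrink hlam u y
  rw [inner_sub_right, inner_eq_of_mem_rangeT hu (mem_minimizers_leastSq.1 hy) hg] at h1
  linarith

variable (A) in
/-- Hoffman's bound for the set of subgradients of `omega lam` at `x` in the range of `Aᵀ`, with the
constraint violation expressed through `shrink`. -/
theorem exists_norm_sub_le_norm_shrink_sub (hlam : 0 < lam) (x : EuclideanSpace ℝ (Fin n))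
    (hx : ∃ p ∈ rangeT A, shrink lam p = x) :
    ∃ κ : ℝ, 0 ≤ κ ∧ ∀ u ∈ rangeT A, ∃ p ∈ rangeT A, shrink lam p = x ∧
      ‖u - p‖ ≤ κ * ‖shrink lam u - x‖ := by
  set V := LinearMap.range A.transpose.toEuclideanLin with hV
  choose l r M hM0 hiff hM using fun i => exists_soft_eq_iff hlam (x i)
  let co : Fin n → V →ₗ[ℝ] ℝ := fun i => (EuclideanSpace.proj (𝕜 := ℝ) i).toLinearMap ∘ₗ V.subtype
  obtain ⟨κ, hκ, h⟩ := exists_hoffman_constant (Sum.elim co fun i => -co i)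
  have key : ∀ p : V, (∀ i, Sum.elim co (fun i => -co i) i p ≤
      Sum.elim r (fun i => -l i) i) ↔ shrink lam (p : EuclideanSpace ℝ (Fin n)) = x := by
    intro p
    simp only [Sum.forall, Sum.elim_inl, Sum.elim_inr, co, LinearMap.neg_apply, neg_le_neg_iff]
    refine ⟨fun h => ?_, fun h => ⟨fun i => ?_, fun i => ?_⟩⟩
    · ext i
      exact (hiff i _).2 ⟨h.2 i, h.1 i⟩
    · exact ((hiff i _).1 (congrArg (fun y => y i) h)).2
    · exact ((hiff i _).1 (congrArg (fun y => y i) h)).1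
  have hMs : 0 ≤ ∑ i, M i := Finset.sum_nonneg fun i _ => hM0 i
  refine ⟨κ * ∑ i, M i, by positivity, fun u hu => ?_⟩
  have hres : ∀ i, M i * |soft lam (u i) - x i| ≤ (∑ i, M i) * ‖shrink lam u - x‖ := by
    intro i
    have h1 : |soft lam (u i) - x i| ≤ ‖shrink lam u - x‖ := by
      simpa [shrink_apply] using PiLp.norm_apply_le (shrink lam u - x) i
    exact mul_le_mul (Finset.single_le_sum (fun i _ => hM0 i) (Finset.mem_univ i)) h1
      (abs_nonneg _) hMs
  obtain ⟨p, hp, hpu⟩ := h (Sum.elim r fun i => -l i)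
    (by obtain ⟨p, hpV, hp⟩ := hx; exact ⟨⟨p, hpV⟩, (key _).2 hp⟩) ⟨u, hu⟩
    ((∑ i, M i) * ‖shrink lam u - x‖) (by positivity) (by
      simp only [Sum.forall, Sum.elim_inl, Sum.elim_inr, co, LinearMap.neg_apply]
      refine ⟨fun i => (hM i (u i)).2.trans (hres i), fun i => ?_⟩
      rw [neg_sub_neg]
      exact (hM i (u i)).1.trans (hres i))
  refine ⟨p, p.2, (key p).1 hp, ?_⟩
  rw [mul_assoc]
  exact hpu

theorem ErrorBound.mono {τ τ' : ℝ} (h : ErrorBound A b lam τ) (hτ : τ ≤ τ') :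
    ErrorBound A b lam τ' := by
  obtain ⟨h0, xbar, hbar, h⟩ := h
  exact ⟨h0.trans_le hτ, xbar, hbar, fun x xs hxs =>
    (h x xs hxs).trans (mul_le_mul_of_nonneg_right hτ (sq_nonneg _))⟩

theorem exists_errorBound (A : Matrix (Fin m) (Fin n) ℝ) (b : EuclideanSpace ℝ (Fin m))
    (hlam : 0 < lam) : ∃ τ, ErrorBound A b lam τ := by
  obtain ⟨q, hq, hbar⟩ := exists_isBilevelSolution_shrink (lam := lam) A b hlam
  set xbar := shrink lam q with hxbar
  have hg := mem_minimizers_leastSq.1 hbar.1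
  obtain ⟨κ, hκ, hH⟩ := exists_norm_sub_le_norm_shrink_sub A hlam xbar ⟨q, hq, rfl⟩
  obtain ⟨C, hC, hCv⟩ := exists_norm_le_transpose_mul A
  refine ⟨2 * (κ * C) ^ 2 + 1, by positivity, xbar, hbar, ?_⟩
  rintro x u ⟨hux, huA⟩
  obtain rfl := eq_shrink_of_mem_subdiff hlam hux
  set x := shrink lam u
  obtain ⟨p, hpA, hpx, hup⟩ := hH u huA
  obtain ⟨v, -, -, hvi, hvn⟩ := hCv (x - xbar)
  rw [← gradLS_eq hg] at hvn
  -- the symmetrized Bregman distance bounds the Bregman distance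
  have h1 : bregman (omega lam) u xbar x ≤ inner ℝ (u - p) (x - xbar) := by
    have h2 := bregman_nonneg (mem_subdiff_omega_shrink hlam p) x
    rw [hpx, bregman] at h2
    rw [bregman, inner_sub_left, ← neg_sub x xbar, inner_neg_right]
    linarith
  have huv : u - p ∈ rangeT A := by
    obtain ⟨y, rfl⟩ := huA
    obtain ⟨y', rfl⟩ := hpA
    exact ⟨y - y', map_sub _ _ _⟩
  have h3 : inner ℝ (u - p) (x - xbar) ≤ (κ * ‖x - xbar‖) * (C * ‖gradLS A b x‖) := by
    rw [← hvi _ huv]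
    exact (real_inner_le_norm _ _).trans (by gcongr)
  have h4 : 1 / 2 * ‖x - xbar‖ ^ 2 ≤ bregman (omega lam) u xbar x :=
    half_norm_sq_le_bregman_shrink hlam u xbar
  set d := ‖x - xbar‖ with hd
  set e := κ * C * ‖gradLS A b x‖ with he
  have h5 : bregman (omega lam) u xbar x ≤ d * e := by
    refine (h1.trans h3).trans (le_of_eq (by rw [he]; ring))
  have h6 : d ≤ 2 * e := by
    by_contra! hc
    have : 0 ≤ e := by positivity
    nlinarith
  have h7 : d * e ≤ 2 * e * e := mul_le_mul_of_nonneg_right h6 (by positivity)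
  have h8 : 2 * e * e = 2 * (κ * C) ^ 2 * ‖gradLS A b x‖ ^ 2 := by rw [he]; ring
  nlinarith [sq_nonneg ‖gradLS A b x‖]

end Bilevel

/-! ### Bregman growth for all subgradients -/

section Growth

variable {m n : ℕ} {A : Matrix (Fin m) (Fin n) ℝ} {b : EuclideanSpace ℝ (Fin m)} {lam : ℝ}

/-- The points whose components have signs compatible with `σ`; the inequality forces
`x i = 0` where `σ i = 0`. -/
def signCone (σ : Fin n → SignType) : Set (EuclideanSpace ℝ (Fin n)) :=
  {x | ∀ i, |x i| ≤ σ i * x i}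

variable (A b) in
/-- For points `x` in a sign cone, either some minimizer of `leastSq A b` in the same cone lies within
a multiple of `‖gradLS A b x‖`, or the gradient is bounded away from zero on the cone. -/
theorem exists_gradLS_bound_signCone (σ : Fin n → SignType) :
    ∃ κ : ℝ, 0 < κ ∧ ∀ x ∈ signCone σ,
      (∃ z ∈ signCone σ, gradLS A b z = 0 ∧ ‖x - z‖ ≤ κ * ‖gradLS A b x‖) ∨
      1 ≤ κ * ‖gradLS A b x‖ := by
  let co : Fin n → EuclideanSpace ℝ (Fin n) →ₗ[ℝ] ℝ :=
    fun i => (EuclideanSpace.proj (𝕜 := ℝ) i).toLinearMap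
  let c : Fin n ⊕ Fin n → EuclideanSpace ℝ (Fin n) →ₗ[ℝ] ℝ :=
    Sum.elim (fun i => (1 - (σ i : ℝ)) • co i) (fun i => (-1 - (σ i : ℝ)) • co i)
  have hc : ∀ x, (∀ i, c i x ≤ 0) ↔ x ∈ signCone σ := by
    intro x
    simp only [c, co, Sum.forall, Sum.elim_inl, Sum.elim_inr, LinearMap.smul_apply, smul_eq_mul,
      signCone, Set.mem_ofPred_eq, abs_le', ← forall_and]
    refine forall_congr' fun i => and_congr ?_ ?_
    · constructor <;> intro h <;> simp at h ⊢ <;> linarith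
    · constructor <;> intro h <;> simp at h ⊢ <;> linarith
  let G := A.transpose.toEuclideanLin ∘ₗ A.toEuclideanLin
  have hG : ∀ x, gradLS A b x = G x - A.transpose.toEuclideanLin b := fun x => by
    simp [G, gradLS]
  by_cases hne : ∃ p, (∀ i, c i p ≤ 0) ∧ G p = A.transpose.toEuclideanLin b
  · obtain ⟨κ, hκ, h⟩ := exists_hoffman_constant_cone c G
    refine ⟨κ, hκ, fun x hx => Or.inl ?_⟩
    obtain ⟨p, hp, hpG, hxp⟩ := h _ hne x ((hc x).2 hx)
    exact ⟨p, (hc p).1 hp, by rw [hG, hpG, sub_self], by rwa [hG]⟩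
  · obtain ⟨κ, hκ, h⟩ := exists_pos_le_norm_sub_of_cone c G _ hne
    exact ⟨κ, hκ, fun x hx => Or.inr (by rw [hG]; exact h x ((hc x).2 hx))⟩

theorem bregman_shrink_le_of_mem_signCone (hlam : 0 < lam) (u : EuclideanSpace ℝ (Fin n))
    {z : EuclideanSpace ℝ (Fin n)}
    (hz : z ∈ signCone fun i => SignType.sign (shrink lam u i)) :
    bregman (omega lam) u z (shrink lam u) ≤ 1 / 2 * ‖shrink lam u - z‖ ^ 2 := by
  rw [bregman_shrink_eq_sum hlam, EuclideanSpace.real_norm_sq_eq, Finset.mul_sum]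
  exact Finset.sum_le_sum fun i _ => bregman_soft_of_abs_le hlam (u i) (z i) (hz i)

theorem bregman_shrink_le (hlam : 0 < lam) (u z : EuclideanSpace ℝ (Fin n)) :
    bregman (omega lam) u z (shrink lam u) ≤
      1 / 2 * ‖shrink lam u - z‖ ^ 2 + 2 * lam * n * ‖shrink lam u - z‖ := by
  have h1 : ∑ i, |shrink lam u i - z i| ≤ n * ‖shrink lam u - z‖ := by
    have := Finset.sum_le_card_nsmul Finset.univ (fun i => |shrink lam u i - z i|)
      ‖shrink lam u - z‖ (fun i _ => by simpa using PiLp.norm_apply_le (shrink lam u - z) i)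
    simpa using this
  have h2 : bregman (omega lam) u z (shrink lam u) ≤
      1 / 2 * ‖shrink lam u - z‖ ^ 2 + 2 * lam * ∑ i, |shrink lam u i - z i| := by
    rw [bregman_shrink_eq_sum hlam, EuclideanSpace.real_norm_sq_eq, Finset.mul_sum,
      Finset.mul_sum, ← Finset.sum_add_distrib]
    exact Finset.sum_le_sum fun i _ => bregman_soft_le hlam (u i) (z i)
  nlinarith

variable (A b) in
/-- The Bregman distance to the set of minimizers is bounded by the squared gradient, for all
subgradients. There are finitely many sign patterns of `x`. If a minimizer of the same sign pattern
exists, the distance to it is purely quadratic; otherwise the gradient is bounded away from zero,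
so that terms linear in `‖gradLS A b x‖` are bounded by its square. -/
theorem exists_bregmanInf_le_gradLS (hlam : 0 < lam) :
    ∃ K : ℝ, 0 < K ∧ ∀ x, ∀ xs ∈ subdiff (omega lam) x,
      bregmanInf (omega lam) (leastSq A b) xs x ≤ K * ‖gradLS A b x‖ ^ 2 := by
  choose κ hκ0 hκ using exists_gradLS_bound_signCone A b
  obtain ⟨C, hC, hCz⟩ := exists_norm_sub_le_gradLS A
  set κs := ∑ σ, κ σ with hκs
  have hle : ∀ σ, κ σ ≤ κs := fun σ =>
    Finset.single_le_sum (fun σ _ => (hκ0 σ).le) (Finset.mem_univ σ)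
  have hκs0 : 0 < κs := (hκ0 fun _ => 0).trans_le (hle _)
  refine ⟨1 / 2 * κs ^ 2 + 1 / 2 * C ^ 2 + 2 * lam * n * C * κs, by positivity, fun x xs hxs => ?_⟩
  have hx := eq_shrink_of_mem_subdiff hlam hxs
  set g := ‖gradLS A b x‖ with hg
  have hmem : x ∈ signCone fun i => SignType.sign (x i) := fun i => by
    simp [sign_mul_self]
  have hg0 : 0 ≤ g := norm_nonneg _
  rcases hκ _ x hmem with ⟨z, hz, hz0, hxz⟩ | h1
  · refine (bregmanInf_le hxs (mem_minimizers_leastSq.2 hz0)).trans ?_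
    have h2 := bregman_shrink_le_of_mem_signCone hlam xs (z := z) (by rwa [← hx])
    rw [← hx] at h2
    have h3 : ‖x - z‖ ^ 2 ≤ (κs * g) ^ 2 :=
      pow_le_pow_left₀ (norm_nonneg _) (hxz.trans (mul_le_mul_of_nonneg_right (hle _) hg0)) 2
    have h4 : 0 ≤ (1 / 2 * C ^ 2 + 2 * lam * n * C * κs) * g ^ 2 := by positivity
    nlinarith
  · obtain ⟨z, hz0, hxz⟩ := hCz b x
    refine (bregmanInf_le hxs (mem_minimizers_leastSq.2 hz0)).trans ?_
    have h2 := bregman_shrink_le hlam xs z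
    rw [← hx] at h2
    have h3 : ‖x - z‖ ^ 2 ≤ (C * g) ^ 2 := pow_le_pow_left₀ (norm_nonneg _) hxz 2
    have h4 : 1 ≤ κs * g := h1.trans (mul_le_mul_of_nonneg_right (hle _) hg0)
    have h5 : ‖x - z‖ ≤ (C * g) * (κs * g) :=
      hxz.trans (le_mul_of_one_le_right (by positivity) h4)
    have h6 : 2 * lam * n * ‖x - z‖ ≤ 2 * lam * n * ((C * g) * (κs * g)) := by gcongr
    have h7 : 0 ≤ 1 / 2 * κs ^ 2 * g ^ 2 := by positivity
    nlinarith

end Growth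

/-! ### Convergence of the linearized Bregman iteration -/

section Rates

variable {m n : ℕ} {A : Matrix (Fin m) (Fin n) ℝ} {b : EuclideanSpace ℝ (Fin m)} {lam : ℝ}

theorem ne_zero_of_gradLS_eq_zero (hAb : A.transpose.toEuclideanLin b ≠ 0)
    {z : EuclideanSpace ℝ (Fin n)} (hz : gradLS A b z = 0) : z ≠ 0 := by
  rintro rfl
  exact hAb (by simpa [gradLS] using hz)

/-- A constant of quadratic growth is at most the Lipschitz constant of the gradient. -/
theorem QuadraticGrowth.le_lipConst (hAb : A.transpose.toEuclideanLin b ≠ 0) {η : ℝ}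
    (h : QuadraticGrowth (leastSq A b) η) : η ≤ lipConst A := by
  have hcl : IsClosed (minimizers (leastSq A b)) := by
    have : minimizers (leastSq A b) = {x | gradLS A b x = 0} :=
      Set.ext fun x => mem_minimizers_leastSq
    rw [this]
    refine isClosed_eq ?_ continuous_const
    exact (LinearMap.continuous_of_finiteDimensional _).comp
      ((LinearMap.continuous_of_finiteDimensional _).sub continuous_const)
  obtain ⟨z₀, hz₀⟩ := exists_gradLS_eq_zero A b
  obtain ⟨z, hz, hdist⟩ := hcl.exists_infDist_eq_dist ⟨z₀, mem_minimizers_leastSq.2 hz₀⟩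
    (0 : EuclideanSpace ℝ (Fin n))
  rw [mem_minimizers_leastSq] at hz
  have h1 := h.2 0
  rw [hdist, dist_eq_norm, leastSq_sub_iInf hz] at h1
  have h2 := norm_sq_le A (0 - z)
  have h3 : 0 < ‖0 - z‖ ^ 2 := by
    have := norm_pos_iff.2 (ne_zero_of_gradLS_eq_zero hAb hz)
    rw [zero_sub, norm_neg]; positivity
  by_contra! hc
  nlinarith [mul_lt_mul_of_pos_right hc h3]

theorem zero_mem_rangeT : (0 : EuclideanSpace ℝ (Fin n)) ∈ rangeT A := ⟨0, map_zero _⟩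

theorem shrink_zero : shrink lam (0 : EuclideanSpace ℝ (Fin n)) = 0 := by
  ext i; simp [shrink]

/-- The error bound at the origin, where `0` is a subgradient, combined with strong convexity. -/
theorem ErrorBound.half_le (hlam : 0 < lam) (hAb : A.transpose.toEuclideanLin b ≠ 0) {τ : ℝ}
    (h : ErrorBound A b lam τ) : 1 / 2 ≤ τ * lipConst A ^ 2 := by
  obtain ⟨hτ, xbar, hbar, h⟩ := h
  have hg := mem_minimizers_leastSq.1 hbar.1
  have h0 := mem_subdiff_omega_shrink hlam (0 : EuclideanSpace ℝ (Fin n))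
  have h1 := half_norm_sq_le_bregman_shrink hlam 0 xbar
  rw [shrink_zero] at h0 h1
  have h2 := h 0 0 ⟨h0, zero_mem_rangeT⟩
  have h3 := mul_le_mul_of_nonneg_left (norm_gradLS_sq_le_norm_sub hg 0) hτ.le
  have h4 : 0 < ‖0 - xbar‖ ^ 2 := by
    have := norm_pos_iff.2 (ne_zero_of_gradLS_eq_zero hAb hg)
    rw [zero_sub, norm_neg]; positivity
  refine le_of_mul_le_mul_right ?_ h4
  linarith

/-- On the range of `Aᵀ` the error bound and quadratic growth give Bregman growth. -/
theorem bregmanGrowthOn_rangeT (hAb : A.transpose.toEuclideanLin b ≠ 0) {τ η : ℝ}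
    (hτ : ErrorBound A b lam τ) (hη : QuadraticGrowth (leastSq A b) η) :
    BregmanGrowthOn (rangeT A) (omega lam) (leastSq A b) (η / (2 * τ * lipConst A ^ 2)) := by
  have hL := lipConst_pos hAb
  have hηL := hη.le_lipConst hAb
  obtain ⟨hτ0, xbar, hbar, h⟩ := hτ
  have hη0 := hη.1
  refine ⟨by positivity, fun x xs hxs => ?_⟩
  rw [bregmanInf_eq hbar hxs.1 hxs.2]
  have h1 := h x xs hxs
  have h2 := norm_gradLS_sq_le (A := A) (b := b) x
  set F := leastSq A b x - ⨅ y, leastSq A b y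
  have hF : 0 ≤ F := by
    by_contra! hc
    nlinarith [sq_nonneg ‖gradLS A b x‖]
  calc η / (2 * τ * lipConst A ^ 2) * bregman (omega lam) xs xbar x
      ≤ η / (2 * τ * lipConst A ^ 2) * (τ * (2 * lipConst A * F)) := by
        gcongr
        exact h1.trans (by gcongr)
    _ = η / lipConst A * F := by field_simp
    _ ≤ 1 * F := by
        gcongr
        exact (div_le_one hL).2 hηL
    _ = F := one_mul F

/-- The decrease of the Bregman distance to the bilevel solution in one step is at least the
decrease of the dual objective, which is computable without knowing the solution. -/
theorem bregman_step_le (hlam : 0 < lam) (hL : 0 < lipConst A) {xbar : EuclideanSpace ℝ (Fin n)}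
    (hbar : gradLS A b xbar = 0) (u : EuclideanSpace ℝ (Fin n)) {t : ℝ} (ht : 0 ≤ t) :
    bregman (omega lam) (u - t • gradLS A b (shrink lam u)) xbar
        (shrink lam (u - t • gradLS A b (shrink lam u))) ≤
      bregman (omega lam) u xbar (shrink lam u) +
        (dualObj A b lam (shrink lam u) u t - 1 / 2 * ‖shrink lam u‖ ^ 2) := by
  rw [bregman_shrink hlam, bregman_shrink hlam, dualObj, inner_sub_left, real_inner_smul_left]
  set x := shrink lam u
  set g := gradLS A b x with hg
  have h1 : inner ℝ g (x - xbar) = ‖A.toEuclideanLin (x - xbar)‖ ^ 2 := by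
    rw [hg, gradLS_eq hbar, inner_transpose_toEuclideanLin, real_inner_self_eq_norm_sq]
  have h2 : ‖g‖ ^ 2 ≤ lipConst A * ‖A.toEuclideanLin (x - xbar)‖ ^ 2 := by
    rw [hg, gradLS_eq hbar]; exact norm_transpose_sq_le A _
  have h3 : 1 / lipConst A * ‖g‖ ^ 2 ≤ inner ℝ g (x - xbar) := by
    rw [h1, one_div_mul_eq_div, div_le_iff₀ hL, mul_comm]; exact h2
  rw [inner_sub_right] at h3
  have h4 := mul_le_mul_of_nonneg_left h3 ht
  linarith

theorem dualObj_le (hlam : 0 < lam) (u : EuclideanSpace ℝ (Fin n)) (t : ℝ) :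
    dualObj A b lam (shrink lam u) u t ≤ 1 / 2 * ‖shrink lam u‖ ^ 2 -
      (t / lipConst A - t ^ 2 / 2) * ‖gradLS A b (shrink lam u)‖ ^ 2 := by
  set g := gradLS A b (shrink lam u) with hg
  have h := half_norm_shrink_add_sq_le hlam u (-(t • g))
  rw [← sub_eq_add_neg, inner_neg_right, real_inner_smul_right, norm_neg, norm_smul, mul_pow,
    Real.norm_eq_abs, sq_abs, real_inner_comm] at h
  rw [dualObj, ← hg]
  refine (add_le_add_left h _).trans (le_of_eq ?_)
  ring

theorem IsLinBregmanIter.eq_shrink {t : ℕ → ℝ} {x xs : ℕ → EuclideanSpace ℝ (Fin n)}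
    (h : IsLinBregmanIter A b lam t x xs) (k : ℕ) : x k = shrink lam (xs k) := by
  cases k with
  | zero => rw [h.x_zero, h.xs_zero, shrink_zero]
  | succ k => rw [h.x_succ, h.xs_succ]

theorem IsLinBregmanIter.mem_rangeT {t : ℕ → ℝ} {x xs : ℕ → EuclideanSpace ℝ (Fin n)}
    (h : IsLinBregmanIter A b lam t x xs) (k : ℕ) : xs k ∈ rangeT A := by
  induction k with
  | zero => rw [h.xs_zero]; exact zero_mem_rangeT
  | succ k ih =>
    obtain ⟨y, hy⟩ := ih
    refine ⟨y - t k • (A.toEuclideanLin (x k) - b), ?_⟩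
    rw [h.xs_succ, ← hy, gradLS, ← map_smul, ← map_sub]

/-- Linear convergence under the error bound, if each step decreases the dual objective by at least
`θ / (2 * lipConst A ^ 2)` times the squared norm of the gradient. -/
theorem IsLinBregmanIter.bregmanInf_le_pow (hlam : 0 < lam)
    (hAb : A.transpose.toEuclideanLin b ≠ 0) {τ η : ℝ} (hτ : ErrorBound A b lam τ)
    (hη : QuadraticGrowth (leastSq A b) η) {t : ℕ → ℝ} {x xs : ℕ → EuclideanSpace ℝ (Fin n)}
    (h : IsLinBregmanIter A b lam t x xs) {θ : ℝ} (hθ0 : 0 ≤ θ) (hθ1 : θ ≤ 1)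
    (ht : ∀ k, 0 ≤ t k)
    (hdec : ∀ k, dualObj A b lam (x k) (xs k) (t k) ≤ 1 / 2 * ‖x k‖ ^ 2 -
      θ / (2 * lipConst A ^ 2) * ‖gradLS A b (x k)‖ ^ 2) (k : ℕ) :
    bregmanInf (omega lam) (leastSq A b) (xs k) (x k) ≤
      (1 - θ * (η / (4 * τ * lipConst A ^ 3)) ^ 2) ^ k *
        bregmanInf (omega lam) (leastSq A b) (xs 0) (x 0) := by
  have hL := lipConst_pos hAb
  have hηL := hη.le_lipConst hAb
  have hη0 := hη.1
  have hhalf := hτ.half_le hlam hAb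
  obtain ⟨hτ0, xbar, hbar, hEB⟩ := hτ
  set q := (η / (4 * τ * lipConst A ^ 3)) ^ 2 with hq
  have hqr : q ≤ 1 / (2 * τ * lipConst A ^ 2) := by
    -- from `η ≤ L` and `1 / 2 ≤ τ * L ^ 2`
    have h1 : η / (4 * τ * lipConst A ^ 3) ≤ 1 / (4 * (τ * lipConst A ^ 2)) := by
      rw [div_le_div_iff₀ (by positivity) (by positivity)]
      calc η * (4 * (τ * lipConst A ^ 2)) ≤ lipConst A * (4 * (τ * lipConst A ^ 2)) := by gcongr
        _ = _ := by ring
    set s := τ * lipConst A ^ 2 with hs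
    have hs0 : 0 < s := by positivity
    calc q ≤ (1 / (4 * s)) ^ 2 := pow_le_pow_left₀ (by positivity) h1 2
      _ ≤ 1 / (2 * s) := by
        rw [div_pow, one_pow, div_le_div_iff₀ (by positivity) (by positivity)]
        nlinarith
      _ = _ := by rw [hs]; ring
  have hq1 : q ≤ 1 := hqr.trans <| by
    rw [div_le_one (by positivity)]; linarith
  have hq0 : 0 ≤ q := sq_nonneg _
  have hfac : 0 ≤ 1 - θ * q := by nlinarith
  have hsub : ∀ k, xs k ∈ subdiff (omega lam) (x k) := fun k => by
    rw [h.eq_shrink k]; exact mem_subdiff_omega_shrink hlam _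
  have hinf := fun k => bregmanInf_eq hbar (hsub k) (h.mem_rangeT k)
  induction k with
  | zero => simp
  | succ k ih =>
    rw [pow_succ', mul_assoc]
    refine le_trans ?_ (mul_le_mul_of_nonneg_left ih hfac)
    rw [hinf, hinf]
    have h1 := bregman_step_le hlam hL (mem_minimizers_leastSq.1 hbar.1) (xs k) (ht k)
    rw [← h.eq_shrink k, ← h.xs_succ, ← h.eq_shrink (k + 1)] at h1
    have h2 := hdec k
    have h3 := hEB (x k) (xs k) ⟨hsub k, h.mem_rangeT k⟩
    set D := bregman (omega lam) (xs k) xbar (x k)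
    have hD : 0 ≤ D := bregman_nonneg (hsub k) xbar
    have h4 : θ * q * D ≤ θ / (2 * lipConst A ^ 2) * ‖gradLS A b (x k)‖ ^ 2 := by
      calc θ * q * D ≤ θ * (1 / (2 * τ * lipConst A ^ 2)) * (τ * ‖gradLS A b (x k)‖ ^ 2) := by
            gcongr
        _ = _ := by field_simp
    linarith

end Rates

end LinBregman

theorem corollary4p2 {m n : ℕ} (A : Matrix (Fin m) (Fin n) ℝ) (b : EuclideanSpace ℝ (Fin m))
    (lam : ℝ) (hlam : 0 < lam) (hAb : A.transpose.toEuclideanLin b ≠ 0) :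
    (∃ τ η : ℝ, LinBregman.ErrorBound A b lam τ ∧
      LinBregman.QuadraticGrowth (LinBregman.leastSq A b) η ∧
      LinBregman.BregmanGrowthOn Set.univ (LinBregman.omega lam) (LinBregman.leastSq A b)
        (η / (2 * τ * LinBregman.lipConst A ^ 2))) ∧
    ∀ τ η : ℝ, LinBregman.ErrorBound A b lam τ →
      LinBregman.QuadraticGrowth (LinBregman.leastSq A b) η →
      LinBregman.BregmanGrowthOn (LinBregman.rangeT A) (LinBregman.omega lam)
        (LinBregman.leastSq A b) (η / (2 * τ * LinBregman.lipConst A ^ 2)) ∧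
      (∀ (t : ℕ → ℝ) (x xs : ℕ → EuclideanSpace ℝ (Fin n)),
        LinBregman.IsLinBregmanIter A b lam t x xs →
        (∀ k, t k = 1 / LinBregman.lipConst A ∨
          LinBregman.IsExactStep A b lam (x k) (xs k) (t k)) →
        ∀ k, LinBregman.bregmanInf (LinBregman.omega lam) (LinBregman.leastSq A b) (xs k) (x k) ≤
          (1 - (η / (4 * τ * LinBregman.lipConst A ^ 3)) ^ 2) ^ k *
            LinBregman.bregmanInf (LinBregman.omega lam) (LinBregman.leastSq A b)
              (xs 0) (x 0)) ∧
      (∀ s ∈ Set.Ioo (0 : ℝ) (2 / LinBregman.lipConst A),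
        ∀ x xs : ℕ → EuclideanSpace ℝ (Fin n),
        LinBregman.IsLinBregmanIter A b lam (fun _ => s) x xs →
        ∀ k, LinBregman.bregmanInf (LinBregman.omega lam) (LinBregman.leastSq A b) (xs k) (x k) ≤
          (1 - s * LinBregman.lipConst A * (2 - s * LinBregman.lipConst A) *
              (η / (4 * τ * LinBregman.lipConst A ^ 3)) ^ 2) ^ k *
            LinBregman.bregmanInf (LinBregman.omega lam) (LinBregman.leastSq A b)
              (xs 0) (x 0)) := by
  have hL := LinBregman.lipConst_pos hAb
  set L := LinBregman.lipConst A with hLdef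
  refine ⟨?_, fun τ η hτ hη => ⟨LinBregman.bregmanGrowthOn_rangeT hAb hτ hη, ?_, ?_⟩⟩
  · obtain ⟨τ₀, hτ₀⟩ := LinBregman.exists_errorBound (lam := lam) A b hlam
    obtain ⟨η, hη⟩ := LinBregman.exists_quadraticGrowth A b hL
    obtain ⟨K, hK, hKb⟩ := LinBregman.exists_bregmanInf_le_gradLS A b hlam
    have hη0 := hη.1
    have hτ0 := hτ₀.1
    have hτle : τ₀ ≤ τ₀ + η * K / L := le_add_of_nonneg_right (by positivity)
    refine ⟨τ₀ + η * K / L, η, hτ₀.mono hτle, hη, by positivity, fun x xs hxs => ?_⟩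
    have h1 := LinBregman.norm_gradLS_sq_le (A := A) (b := b) x
    have h2 := (hKb x xs hxs.1).trans (mul_le_mul_of_nonneg_left h1 hK.le)
    rw [← hLdef] at h2
    set F := LinBregman.leastSq A b x - ⨅ y, LinBregman.leastSq A b y
    have hF : 0 ≤ F := le_trans (by positivity) (hη.2 x)
    set τ := τ₀ + η * K / L with hτ
    have hτp : 0 < τ := hτ0.trans_le hτle
    have h3 : η * K ≤ τ * L := by
      rw [hτ, add_mul, div_mul_cancel₀ _ hL.ne']
      linarith [mul_pos hτ0 hL]
    calc η / (2 * τ * L ^ 2) * LinBregman.bregmanInf (LinBregman.omega lam)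
          (LinBregman.leastSq A b) xs x
        ≤ η / (2 * τ * L ^ 2) * (K * (2 * L * F)) := by gcongr
      _ = (η * K) / (τ * L) * F := by field_simp
      _ ≤ 1 * F := by
          gcongr
          exact (div_le_one (by positivity)).2 h3
      _ = F := one_mul F
  · intro t x xs h hstep k
    have hunit : ∀ k, LinBregman.dualObj A b lam (x k) (xs k) (1 / L) ≤ 1 / 2 * ‖x k‖ ^ 2 -
        1 / (2 * L ^ 2) * ‖LinBregman.gradLS A b (x k)‖ ^ 2 := fun k => by
      have := LinBregman.dualObj_le (A := A) (b := b) hlam (xs k) (1 / L)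
      rw [← h.eq_shrink k, ← hLdef] at this
      refine this.trans (le_of_eq ?_)
      field_simp
      ring
    have := h.bregmanInf_le_pow hlam hAb hτ hη zero_le_one le_rfl
      (fun k => (hstep k).elim (fun e => by rw [e]; positivity) fun e => e.1.le)
      (fun k => (hstep k).elim (fun e => by rw [e]; exact hunit k)
        fun e => (e.2 (1 / L) (by positivity)).trans (hunit k)) k
    rwa [one_mul] at this
  · rintro s ⟨hs0, hs2⟩ x xs h k
    have hsL : s * L < 2 := (lt_div_iff₀ hL).1 hs2
    have hsL0 : 0 < s * L := mul_pos hs0 hL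
    refine h.bregmanInf_le_pow hlam hAb hτ hη (mul_nonneg hsL0.le (by linarith))
      (by nlinarith [sq_nonneg (s * L - 1)]) (fun _ => hs0.le) (fun k => ?_) k
    have := LinBregman.dualObj_le (A := A) (b := b) hlam (xs k) s
    rw [← h.eq_shrink k, ← hLdef] at this
    refine this.trans (le_of_eq ?_)
    rw [← hLdef]
    field_simp
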